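/- **Proposition 5.5 (Broadhurst duality for mixed associators).** Let $\mathbf{k}$ be a commutative $\mathbb{Q}$-algebra. Let $\mathfrak{t}^0_{3,2}(\mathbf{k})$ be the completed free Lie $\mathbf{k}$-algebra on $e^0,e^1,e^{-1}$, so that its completed enveloping algebra is $\mathbf{k}\langle\langle e^0,e^1,e^{-1}\rangle\rangle$ and $\exp\mathfrak{t}^0_{3,2}(\mathbf{k})$ is the set of group-like series in it (all generators being primitive). Let $\mathfrak{t}^0_{4,2}(\mathbf{k})$ be the completed Lie $\mathbf{k}$-algebra with generators $t^{12},t^{13}$ and $t(a)^{ij}$ ($i\ne j$ in $\{2,3,4\}$, $a\in\mathbb{Z}/2\mathbb{Z}$) and relations $$t(a)^{ij}=t(-a)^{ji},\qquad [t(a)^{ij},\,t(a+b)^{il}+t(b)^{jl}]=0,\qquad [t^{1p},\,t(a)^{ij}]=0,$$ $$\Big[t^{1p}+t^{1q}+\sum_{c}t(c)^{pq},\,t(a)^{pq}\Big]=0,\qquad \Big[t^{1p},\,t^{1q}+\sum_{c}t(c)^{pq}\Big]=0,$$ for $a,b\in\mathbb{Z}/2\mathbb{Z}$, where $i,j,l$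 run over $\{2,3,4\}$, $p,q$ run over $\{2,3\}$, and the indices within each relation are distinct; the sums are over $c\in\mathbb{Z}/2\mathbb{Z}$. Write $t_+^{ij}=t(0)^{ij}$ and $t_-^{ij}=t(1)^{ij}$. Let $\mathrm{PENT}(2,\mathbf{k})$ be the set of all $h=h(e^0,e^1,e^{-1})\in\exp\mathfrak{t}^0_{3,2}(\mathbf{k})$ that satisfy the mixed pentagon equation $$\begin{aligned}&h(t^{12},\,t_+^{23}+t_+^{24},\,t_-^{23}+t_-^{24})\;h(t^{13}+t_+^{23}+t_-^{23},\,t_+^{34},\,t_-^{34})\\&\quad=h(t_+^{23},\,t_+^{34},\,0)\;h(t^{12}+t^{13}+t_+^{23}+t_-^{23},\,t_+^{24}+t_+^{34},\,t_-^{24}+t_-^{34})\;h(t^{12},\,t_+^{23},\,t_-^{23})\end{aligned}$$ in the completed universal enveloping algebra of $\mathfrak{t}^0_{4,2}(\mathbf{k})$. Let $\mathcal{T}$ be the continuous involutive algebra automorphism of $\mathbf{k}\langle\langle e^0,e^1,e^{-1}\rangle\rangle$ defined by $e^0\leftrightarrow e^1$ and $e^{-1}\leftrightarrow e^\infty:=-e^0-e^1-e^{-1}$.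 For $h\in\mathrm{PENT}(2,\mathbf{k})$ let $\alpha_h\in\mathbf{k}$ be the coefficient of $e^{-1}$ in $h$. Then every $h\in\mathrm{PENT}(2,\mathbf{k})$ satisfies, with $\mathcal{T}(h)$ invertible, $$h=\exp(-\alpha_h e^1)\,\mathcal{T}(h)^{-1}\,\exp(-\alpha_h e^0).$$ -/

import Mathlib

open Finset

/-- Formal power series `k⟨⟨X⟩⟩` in non-commuting variables indexed by `X`: a series is the family of
its coefficients, indexed by the words in `X`. -/
@[ext] structure NCSeries (X k : Type*) where
  /-- The coefficient at a word. -/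
  coeff : List X → k

namespace NCSeries

variable {X Y k R : Type*}

theorem coeff_injective : Function.Injective (coeff : NCSeries X k → List X → k) :=
  fun _ _ => NCSeries.ext

instance [SMul R k] : SMul R (NCSeries X k) := ⟨fun c f => ⟨c • f.coeff⟩⟩

section Module

variable [AddCommGroup k]

instance : Zero (NCSeries X k) := ⟨⟨0⟩⟩

instance : Add (NCSeries X k) := ⟨fun f g => ⟨f.coeff + g.coeff⟩⟩

instance : Neg (NCSeries X k) := ⟨fun f => ⟨-f.coeff⟩⟩

instance : Sub (NCSeries X k) := ⟨fun f g => ⟨f.coeff - g.coeff⟩⟩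

instance : AddCommGroup (NCSeries X k) :=
  coeff_injective.addCommGroup coeff rfl (fun _ _ => rfl) (fun _ => rfl) (fun _ _ => rfl)
    (fun _ _ => rfl) (fun _ _ => rfl)

/-- The coefficients, as an additive homomorphism. -/
def coeffHom : NCSeries X k →+ (List X → k) where
  toFun := coeff
  map_zero' := rfl
  map_add' _ _ := rfl

instance [Semiring R] [Module R k] : Module R (NCSeries X k) :=
  Function.Injective.module R (coeffHom : NCSeries X k →+ (List X → k)) coeff_injective
    (fun _ _ => rfl)

@[simp] theorem coeff_zero (w : List X) : (0 : NCSeries X k).coeff w = 0 := rfl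

@[simp] theorem coeff_add (f g : NCSeries X k) (w : List X) :
    (f + g).coeff w = f.coeff w + g.coeff w := rfl

@[simp] theorem coeff_neg (f : NCSeries X k) (w : List X) : (-f).coeff w = -f.coeff w := rfl

@[simp] theorem coeff_sub (f g : NCSeries X k) (w : List X) :
    (f - g).coeff w = f.coeff w - g.coeff w := rfl

end Module

@[simp] theorem coeff_smul [SMul R k] (c : R) (f : NCSeries X k) (w : List X) :
    (c • f).coeff w = c • f.coeff w := rfl

section Ring

variable [CommRing k]

/-- The constant series `1`: coefficient `1` at the empty word. -/
instance : One (NCSeries X k) := ⟨⟨fun w => if w.isEmpty then 1 else 0⟩⟩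

/-- The concatenation product: the coefficient of `f * g` at `w` is the sum of `f(u) g(v)` over all
factorizations `w = uv`. -/
instance : Mul (NCSeries X k) :=
  ⟨fun f g => ⟨fun w => ∑ i ∈ range (w.length + 1), f.coeff (w.take i) * g.coeff (w.drop i)⟩⟩

@[simp] theorem coeff_one_nil : (1 : NCSeries X k).coeff [] = 1 := rfl

@[simp] theorem coeff_one_cons (x : X) (w : List X) : (1 : NCSeries X k).coeff (x :: w) = 0 := rfl

theorem coeff_mul (f g : NCSeries X k) (w : List X) :
    (f * g).coeff w =
      ∑ i ∈ range (w.length + 1), f.coeff (w.take i) * g.coeff (w.drop i) := rfl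

/-- The series whose coefficient at `w` is the coefficient of `f` at `xw`. -/
def shift (f : NCSeries X k) (x : X) : NCSeries X k := ⟨fun w => f.coeff (x :: w)⟩

theorem coeff_mul_nil (f g : NCSeries X k) :
    (f * g).coeff [] = f.coeff [] * g.coeff [] := by
  simp [coeff_mul]

theorem coeff_mul_cons (f g : NCSeries X k) (x : X) (w : List X) :
    (f * g).coeff (x :: w) = f.coeff [] * g.coeff (x :: w) + (f.shift x * g).coeff w := by
  rw [coeff_mul, List.length_cons, Finset.sum_range_succ', add_comm]
  rfl

theorem right_distrib' (f g h : NCSeries X k) : (f + g) * h = f * h + g * h := by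
  ext w
  simp [coeff_mul, add_mul, Finset.sum_add_distrib]

theorem left_distrib' (f g h : NCSeries X k) : f * (g + h) = f * g + f * h := by
  ext w
  simp [coeff_mul, mul_add, Finset.sum_add_distrib]

theorem smul_mul' (c : k) (f g : NCSeries X k) : (c • f) * g = c • (f * g) := by
  ext w
  simp [coeff_mul, Finset.mul_sum, mul_assoc]

theorem shift_mul (f g : NCSeries X k) (x : X) :
    (f * g).shift x = f.coeff [] • g.shift x + f.shift x * g := by
  ext w
  exact coeff_mul_cons f g x w

theorem mul_assoc' (f g h : NCSeries X k) : f * g * h = f * (g * h) := by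
  ext w
  induction w generalizing f with
  | nil => simp [coeff_mul_nil, mul_assoc]
  | cons x w ih =>
    rw [coeff_mul_cons, coeff_mul_cons, shift_mul, right_distrib', smul_mul', coeff_add, ih,
      coeff_mul_nil, coeff_mul_cons, coeff_smul, smul_eq_mul]
    ring

theorem zero_mul' (f : NCSeries X k) : 0 * f = 0 := by
  ext w
  simp [coeff_mul]

theorem mul_zero' (f : NCSeries X k) : f * 0 = 0 := by
  ext w
  simp [coeff_mul]

theorem one_mul' (f : NCSeries X k) : 1 * f = f := by
  ext w
  cases w with
  | nil => simp [coeff_mul_nil]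
  | cons x w =>
    have h : (1 : NCSeries X k).shift x = 0 := rfl
    simp [coeff_mul_cons, h, zero_mul']

theorem mul_one' (f : NCSeries X k) : f * 1 = f := by
  ext w
  induction w generalizing f with
  | nil => simp [coeff_mul_nil]
  | cons x w ih =>
    rw [coeff_mul_cons, coeff_one_cons, ih, mul_zero, zero_add]
    rfl

instance : Ring (NCSeries X k) :=
  { (inferInstance : AddCommGroup (NCSeries X k)) with
    mul := (· * ·)
    one := 1
    mul_assoc := mul_assoc'
    one_mul := one_mul'
    mul_one := mul_one'
    left_distrib := left_distrib'
    right_distrib := right_distrib'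
    zero_mul := zero_mul'
    mul_zero := mul_zero' }

open Classical in
/-- The variable `x`, as a series. -/
noncomputable def var (x : X) : NCSeries X k := ⟨fun w => if w = [x] then 1 else 0⟩

/-- Substitution: for series `s x` without constant term, `subst s` is the continuous homomorphism
of `k`-algebras that sends the variable `x` to `s x`, that is
`h ↦ ∑ h(x₁ ⋯ xₙ) (s x₁) ⋯ (s xₙ)`, the sum over all words. Only words of length at most that of
`v` contribute to the coefficient at `v`. -/
def subst [Fintype X] (s : X → NCSeries Y k) (h : NCSeries X k) : NCSeries Y k :=
  ⟨fun v => ∑ n ∈ range (v.length + 1), ∑ w : Fin n → X,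
    h.coeff (List.ofFn w) * ((List.ofFn fun i => s (w i)).prod).coeff v⟩

/-- The exponential `∑ fⁿ / n!` of a series `f` without constant term. Only the powers with `n`
at most the length of `v` contribute to the coefficient at `v`. -/
def exp [Algebra ℚ k] (f : NCSeries X k) : NCSeries X k :=
  ⟨fun v => ∑ n ∈ range (v.length + 1), ((n.factorial : ℚ)⁻¹) • (f ^ n).coeff v⟩

/-- The list, with multiplicity, of the shuffles of two words. -/
def shuffles : List X → List X → List (List X)
  | [], v => [v]
  | a :: u, [] => [a :: u]
  | a :: u, b :: v =>
    (shuffles u (b :: v)).map (a :: ·) ++ (shuffles (a :: u) v).map (b :: ·)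
  termination_by u v => u.length + v.length

/-- Group-like series, for the continuous coproduct `Δ` with `Δ x = x ⊗ 1 + 1 ⊗ x` for every
variable `x`: the constant term is `1` and `Δ h = h ⊗ h`. The coefficient of `Δ h` at `u ⊗ v` is the
sum of the coefficients of `h` at the shuffles of `u` and `v`. -/
def IsGroupLike (h : NCSeries X k) : Prop :=
  h.coeff [] = 1 ∧
    ∀ u v : List X, ((shuffles u v).map h.coeff).sum = h.coeff u * h.coeff v

/-- The commutator. -/
def ringComm (f g : NCSeries X k) : NCSeries X k := f * g - g * f

/-- The closed two-sided ideal generated by `S`: the closure, for the filtration by degree, of the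
two-sided ideal generated by `S`. -/
def closedIdeal (S : Set (NCSeries X k)) : TwoSidedIdeal (NCSeries X k) :=
  TwoSidedIdeal.mk'
    {f | ∀ n : ℕ, ∃ g ∈ TwoSidedIdeal.span S, ∀ w : List X, w.length ≤ n → f.coeff w = g.coeff w}
    (fun _ => ⟨0, TwoSidedIdeal.zero_mem _, fun _ _ => rfl⟩)
    (by
      intro f f' hf hf' n
      obtain ⟨g, hg, h⟩ := hf n
      obtain ⟨g', hg', h'⟩ := hf' n
      exact ⟨g + g', TwoSidedIdeal.add_mem _ hg hg', fun w hw => by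
        rw [coeff_add, coeff_add, h w hw, h' w hw]⟩)
    (by
      intro f hf n
      obtain ⟨g, hg, h⟩ := hf n
      exact ⟨-g, TwoSidedIdeal.neg_mem _ hg, fun w hw => by
        rw [coeff_neg, coeff_neg, h w hw]⟩)
    (by
      intro r f hf n
      obtain ⟨g, hg, h⟩ := hf n
      refine ⟨r * g, TwoSidedIdeal.mul_mem_left _ _ _ hg, fun w hw => ?_⟩
      rw [coeff_mul, coeff_mul]
      refine Finset.sum_congr rfl fun i _ => ?_
      rw [h _ (le_trans (by simp) hw)])
    (by
      intro f r hf n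
      obtain ⟨g, hg, h⟩ := hf n
      refine ⟨g * r, TwoSidedIdeal.mul_mem_right _ _ _ hg, fun w hw => ?_⟩
      rw [coeff_mul, coeff_mul]
      refine Finset.sum_congr rfl fun i _ => ?_
      rw [h _ (le_trans (by simp) hw)])

end Ring

end NCSeries

namespace Cyclotomic

open NCSeries

/-- The generators of `𝔱⁰_{m+2,N}`. The strands `2, …, m+2` are indexed by `Fin (m + 1)`
(`i : Fin (m + 1)` stands for the strand `i + 2`).
`pole j` is `t^{1,j+2}`, for the strands other than the last one;
`chord a i j` is `t(a)^{i+2,j+2}`, for `i ≠ j`. -/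
inductive Gen (m N : ℕ) : Type
  | pole (j : Fin m) : Gen m N
  | chord (a : ZMod N) (i j : Fin (m + 1)) (h : i ≠ j) : Gen m N

/-- The indices of the free generators of `𝔱⁰_{3,N}`: `none` stands for `e^0 = t^{12}` and `some a`
for `e^{ζ^a} = t(a)^{23}`, where `ζ` is the fixed generator of `μ_N`. -/
abbrev Gen3 (N : ℕ) : Type := Option (ZMod N)

section

variable {m N : ℕ} {k : Type*} [CommRing k]

/-- The generator `t^{1,j+2}`. -/
noncomputable def tp (j : Fin m) : NCSeries (Gen m N) k :=
  var (Gen.pole j)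

/-- The generator `t(a)^{i+2,j+2}`, with the convention that it is `0` for `i = j`. -/
noncomputable def tc (a : ZMod N) (i j : Fin (m + 1)) :
    NCSeries (Gen m N) k :=
  if h : i ≠ j then var (Gen.chord a i j h) else 0

variable [NeZero N]

/-- The sum of `t(c)^{i+2,j+2}` over all `c` in `ℤ/N`. -/
noncomputable def tcSum (i j : Fin (m + 1)) :
    NCSeries (Gen m N) k :=
  ∑ c : ZMod N, tc c i j

/-- The defining relations of `𝔱⁰_{m+2,N}`, as elements that are to vanish: those of `𝔱_{m+2,N}`
that do not involve the generator `t^{1,m+2}`. -/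
inductive Relation (m N : ℕ) [NeZero N] (k : Type*) [CommRing k] : NCSeries (Gen m N) k → Prop
  | symm (a : ZMod N) (i j : Fin (m + 1)) (hij : i ≠ j) :
      Relation m N k (tc a i j - tc (-a) j i)
  | triangle (a b : ZMod N) (i j l : Fin (m + 1)) (hij : i ≠ j) (hil : i ≠ l) (hjl : j ≠ l) :
      Relation m N k (ringComm (tc a i j) (tc (a + b) i l + tc b j l))
  | poles_chord (a : ZMod N) (i j : Fin m) (hij : i ≠ j) :
      Relation m N k (ringComm (tp i + tp j + tcSum i.castSucc j.castSucc) (tc a i.castSucc j.castSucc))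
  | pole_pole (i j : Fin m) (hij : i ≠ j) :
      Relation m N k (ringComm (tp i) (tp j + tcSum i.castSucc j.castSucc))
  | pole_chord (a : ZMod N) (i : Fin m) (j l : Fin (m + 1)) (hij : i.castSucc ≠ j)
      (hil : i.castSucc ≠ l) (hjl : j ≠ l) :
      Relation m N k (ringComm (tp i) (tc a j l))
  | chord_chord (a b : ZMod N) (i j l p : Fin (m + 1)) (hij : i ≠ j) (hil : i ≠ l) (hip : i ≠ p)
      (hjl : j ≠ l) (hjp : j ≠ p) (hlp : l ≠ p) :
      Relation m N k (ringComm (tc a i j) (tc b l p))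

/-- The closed two-sided ideal of the relations of `𝔱⁰_{m+2,N}`. -/
def relationIdeal (m N : ℕ) [NeZero N] (k : Type*) [CommRing k] :
    TwoSidedIdeal (NCSeries (Gen m N) k) :=
  closedIdeal {r | Relation m N k r}

/-- The completed universal enveloping algebra of `𝔱⁰_{m+2,N}(k)`. -/
abbrev UHat (m N : ℕ) [NeZero N] (k : Type*) [CommRing k] : Type _ :=
  (relationIdeal m N k).ringCon.Quotient

/-- The class of a series in the completed universal enveloping algebra. -/
def toUHat (f : NCSeries (Gen m N) k) : UHat m N k :=
  (relationIdeal m N k).ringCon.mk' f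

end

section

variable {m N : ℕ} {k : Type*} [CommRing k] [NeZero N]

/-- The map `h ↦ h^f = h^{f⁻¹(1), f⁻¹(2), f⁻¹(3)}` from series on `𝔱⁰_{3,N}` to the completed
enveloping algebra of `𝔱⁰_{m+2,N}`, for a partially defined map `f` from `{1, …, m+2}` to `{1, 2, 3}`
with `f(1) = 1`. Here `A`, `B`, `C` are the sets of the strands `≥ 2` in `f⁻¹(1)`, `f⁻¹(2)`, `f⁻¹(3)`,
and the last strand is not in `B`. -/
noncomputable def insertCyc [Algebra ℚ k] (A B C : Finset (Fin (m + 1))) (h : NCSeries (Gen3 N) k) :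
    UHat m N k :=
  toUHat (subst
    (fun
      | none =>
          (∑ j : Fin m with j.castSucc ∈ B, tp j)
            + (1 / 2 : ℚ) • (∑ i ∈ B, ∑ j ∈ B, tcSum i j)
            + (∑ i ∈ A, ∑ j ∈ B, tcSum i j)
      | some a => ∑ i ∈ B, ∑ j ∈ C, tc a i j)
    h)

/-- The map `g ↦ g^f = g^{f⁻¹(1), f⁻¹(2), f⁻¹(3)}` from series on `𝔱⁰_{3,1}` to the completed
enveloping algebra of `𝔱⁰_{m+2,N}`, for a partially defined map `f` from `{2, …, m+2}` to `{1, 2, 3}`,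
where `A`, `B`, `C` are `f⁻¹(1)`, `f⁻¹(2)`, `f⁻¹(3)`. -/
noncomputable def insertOne (A B C : Finset (Fin (m + 1))) (g : NCSeries (Gen3 1) k) :
    UHat m N k :=
  toUHat (subst
    (fun
      | none => ∑ i ∈ A, ∑ j ∈ B, tc 0 i j
      | some _ => ∑ i ∈ B, ∑ j ∈ C, tc 0 i j)
    g)

/-- The map `δ`, induced by `t^{12} ↦ t^{12}`, `t(0)^{23} ↦ t^{23}`, and `t(a)^{23} ↦ 0` for
`a ≠ 0`. -/
noncomputable def delta (h : NCSeries (Gen3 N) k) : NCSeries (Gen3 1) k :=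
  subst
    (fun
      | none => var none
      | some a => if a = 0 then var (some 0) else 0)
    h

/-- The mixed pentagon equation
`h^{1,2,34} h^{12,3,4} = g^{2,3,4} h^{1,23,4} h^{1,2,3}` in the completed enveloping algebra of
`𝔱⁰_{4,N}(k)`; the strands `2`, `3`, `4` are `0`, `1`, `2` in `Fin 3`. -/
def MixedPentagon [Algebra ℚ k] (g : NCSeries (Gen3 1) k) (h : NCSeries (Gen3 N) k) : Prop :=
  (insertCyc ∅ {0} {1, 2} h * insertCyc {0} {1} {2} h : UHat 2 N k)
    = insertOne {0} {1} {2} g * insertCyc ∅ {0, 1} {2} h * insertCyc ∅ {0} {1} h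

end

/-- The set `PENT(N, k)` of the group-like series `h` such that `(δ(h), h)` satisfies the mixed
pentagon equation. -/
def PENT (N : ℕ) [NeZero N] (k : Type*) [CommRing k] [Algebra ℚ k] :
    Set (NCSeries (Gen3 N) k) :=
  {h | IsGroupLike h ∧ MixedPentagon (delta h) h}

section LevelTwo

variable {k : Type*} [CommRing k]

/-- The variable `e^0`. -/
noncomputable def eZero : NCSeries (Gen3 2) k := var none

/-- The variable `e^1`. -/
noncomputable def eOne : NCSeries (Gen3 2) k := var (some 0)

/-- The variable `e^{-1}`. -/
noncomputable def eNegOne : NCSeries (Gen3 2) k := var (some 1)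

/-- `e^∞ = -e^0 - e^1 - e^{-1}`. -/
noncomputable def eInfty : NCSeries (Gen3 2) k := -eZero - eOne - eNegOne

/-- The continuous algebra involution with `e^0 ↔ e^1` and `e^{-1} ↔ e^∞`. -/
noncomputable def involT (h : NCSeries (Gen3 2) k) : NCSeries (Gen3 2) k :=
  subst
    (fun
      | none => eOne
      | some a => if a = 0 then eZero else eInfty)
    h

/-- The coefficient of `e^{-1}`. -/
def coeffNegOne (h : NCSeries (Gen3 2) k) : k := h.coeff [some 1]

end LevelTwo

end Cyclotomic

/-!
The mixed pentagon equation holds in the power series over every algebra with a representation of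
`𝔱⁰_{4,2}`, so every representation gives an identity for `h` (`BraidRep.mixedPentagon`). The
representations that are needed come from maps of the configuration space
`{(z₂, z₃) : z₂, z₃ ≠ 0, ±1, z₂ ≠ ± z₃}` to simpler spaces. Write `α` for the coefficient of `e⁻¹`.

* The characters show that the coefficients of `e⁰` and `e¹` in `h` vanish. As `h` is group-like,
  it then follows that an element which commutes with all arguments can be split off:
  `h(x + az, y + bz, w + cz) = h(x, y, w) exp(cαz)` (`eval3_add_smul`).
* Two pencils of conics, which are maps to `ℙ¹ ∖ {0, 1, ∞}`, give the duality
  `h(x, y, 0) h(y, x, 0) = 1` of the associator (`eval3_mul_eval3_swap`) and the duality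
  `h(0, x, y) h(x, 0, -x-y) = exp(-αx)` modulo `e⁰` (`eval3_zero_mul_eval3`).
* When the divisor `z₂ = -z₃` is filled in, the space becomes the configuration space of two points
  of `ℙ¹ ∖ {0, ±1, ∞}`. On this space `z ↦ (1-z)/(1+z)`, which induces the involution `𝒯`, acts. The
  pentagon and its image under this automorphism, combined with the exchange of the two points, are
  mapped further to the configuration space of two points of `ℙ¹ ∖ {±1, ∞}`. Let `s` be the residue
  at `z₂ = z₃`, let `b, c` be the residues at `z₂ = 1, -1` and `y, z` those at `z₃ = 1, -1`. The
  two identities are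
  `h(0, s+b, c) h(s, y, z) = h(s, y, 0) h(0, b+y, c+z)` and
  `h(y, s, -s-y-z) h(s+b, 0, -s-b-c) = h(b+y, 0, -b-y-c-z) exp(-2αs) h(y, s, 0)`.
  The two dualities above cancel every factor except for those in `s, y, z`, and what is left is
  Broadhurst duality for `h(s, y, z)` (`eval3_duality`).
* The elements `s, y, z` are free. Explicitly, they act on the free algebra by left multiplication
  and `b, c` act by derivations, so the identity holds for the variables themselves
  (`eval3_mulVar_duality`, `eval_mulVar_injective`).
-/

namespace NCSeries

/-! ### Evaluation of non-commutative series in a `k`-algebra -/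

section Eval

variable {X Y k E : Type*} [Fintype X] [Fintype Y] [CommRing k] [Ring E] [Algebra k E]

theorem sum_ofFn_succ {M : Type*} [AddCommMonoid M] (n : ℕ) (F : List X → M) :
    ∑ w : Fin (n + 1) → X, F (List.ofFn w) = ∑ x, ∑ w : Fin n → X, F (x :: List.ofFn w) := by
  rw [← (Fin.consEquiv fun _ => X).sum_comp, Fintype.sum_prod_type]
  simp [Fin.consEquiv, List.ofFn_succ]

/-- The value at `p` of the component of degree `n` of a series. -/
def evalCoeff (p : X → E) (n : ℕ) (f : NCSeries X k) : E :=
  ∑ w : Fin n → X, f.coeff (List.ofFn w) • ((List.ofFn w).map p).prod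

theorem evalCoeff_zero (p : X → E) (f : NCSeries X k) :
    evalCoeff p 0 f = algebraMap k E (f.coeff []) := by
  simp [evalCoeff, Algebra.algebraMap_eq_smul_one]

theorem evalCoeff_succ (p : X → E) (n : ℕ) (f : NCSeries X k) :
    evalCoeff p (n + 1) f = ∑ x, p x * evalCoeff p n (f.shift x) := by
  rw [evalCoeff, sum_ofFn_succ n fun w => f.coeff w • (w.map p).prod]
  simp [evalCoeff, shift, Finset.mul_sum]

theorem evalCoeff_add (p : X → E) (n : ℕ) (f g : NCSeries X k) :
    evalCoeff p n (f + g) = evalCoeff p n f + evalCoeff p n g := by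
  simp [evalCoeff, add_smul, Finset.sum_add_distrib]

theorem evalCoeff_smul (p : X → E) (n : ℕ) (c : k) (f : NCSeries X k) :
    evalCoeff p n (c • f) = c • evalCoeff p n f := by
  simp [evalCoeff, Finset.smul_sum, mul_smul]

theorem evalCoeff_one (p : X → E) (n : ℕ) :
    evalCoeff p n (1 : NCSeries X k) = if n = 0 then 1 else 0 := by
  cases n with
  | zero => simp [evalCoeff_zero]
  | succ n => simp [evalCoeff, List.ofFn_succ]

theorem evalCoeff_mul (p : X → E) (n : ℕ) (f g : NCSeries X k) :
    evalCoeff p n (f * g) = ∑ ij ∈ antidiagonal n, evalCoeff p ij.1 f * evalCoeff p ij.2 g := by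
  induction n generalizing f with
  | zero => simp [evalCoeff_zero, coeff_mul_nil]
  | succ n ih =>
    rw [evalCoeff_succ, Finset.Nat.sum_antidiagonal_succ]
    simp only [shift_mul, evalCoeff_add, evalCoeff_smul, ih, mul_add, Finset.sum_add_distrib,
      evalCoeff_succ p _ f, evalCoeff_succ p n g, evalCoeff_zero, Finset.sum_mul]
    congr 1
    · simp [Finset.mul_sum, Algebra.smul_def, Algebra.left_comm]
    · rw [Finset.sum_comm]
      simp [Finset.mul_sum, mul_assoc]

theorem evalCoeff_congr (p : X → E) (n : ℕ) {f g : NCSeries X k}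
    (h : ∀ w : List X, w.length ≤ n → f.coeff w = g.coeff w) :
    evalCoeff p n f = evalCoeff p n g :=
  Finset.sum_congr rfl fun w _ => by rw [h _ (by simp)]

/-- The evaluation of a series at elements `p x` of a `k`-algebra `E`, that is the substitution
`x ↦ p x ε`. A formal variable `ε` is used to make the substitution converge: the component of
degree `n` contributes to the coefficient of `εⁿ`. -/
noncomputable def eval (p : X → E) : NCSeries X k →+* PowerSeries E where
  toFun f := PowerSeries.mk fun n => evalCoeff p n f
  map_zero' := by
    ext n
    simp [evalCoeff]
  map_one' := by
    ext n
    simp [evalCoeff_one, PowerSeries.coeff_one]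
  map_add' f g := by
    ext n
    simp [evalCoeff_add]
  map_mul' f g := by
    ext n
    simp [evalCoeff_mul, PowerSeries.coeff_mul]

theorem coeff_eval (p : X → E) (n : ℕ) (f : NCSeries X k) :
    PowerSeries.coeff n (eval p f) = evalCoeff p n f := by
  simp [eval]

theorem eval_smul (p : X → E) (c : k) (f : NCSeries X k) : eval p (c • f) = c • eval p f := by
  ext n
  have : c • eval p f = PowerSeries.mk fun n => c • evalCoeff p n f := by
    ext n
    rw [PowerSeries.coeff_mk, ← coeff_eval]
    rfl
  rw [this, PowerSeries.coeff_mk, coeff_eval, evalCoeff_smul]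

theorem eval_var (p : X → E) (x : X) :
    eval p (var x : NCSeries X k) = PowerSeries.monomial 1 (p x) := by
  classical
  ext n
  rw [coeff_eval, PowerSeries.coeff_monomial]
  match n with
  | 0 => simp [evalCoeff_zero, var]
  | 1 =>
    have h0 (y : X) : (var x : NCSeries X k).coeff [y] = if y = x then 1 else 0 := by simp [var]
    simp [evalCoeff_succ, evalCoeff_zero, shift, h0]
  | n + 2 => simp [evalCoeff, var, List.ofFn_succ]

/-- Evaluation after a linear substitution. -/
theorem eval_subst (p : Y → E) (q : X → E) (t : X → NCSeries Y k)
    (ht : ∀ x, eval p (t x) = PowerSeries.monomial 1 (q x)) (h : NCSeries X k) :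
    eval p (subst t h) = eval q h := by
  have hprod (l : List X) : eval p ((l.map t).prod) =
      PowerSeries.monomial l.length ((l.map q).prod) := by
    induction l with
    | nil => simp [PowerSeries.monomial_zero_eq_C_apply]
    | cons x l ih =>
      rw [List.map_cons, List.prod_cons, map_mul, ih, ht, PowerSeries.monomial_mul_monomial,
        List.map_cons, List.prod_cons, List.length_cons, add_comm]
  ext n
  rw [coeff_eval, coeff_eval]
  have key : evalCoeff p n (subst t h) = ∑ m ∈ range (n + 1), ∑ w : Fin m → X,
      h.coeff (List.ofFn w) • evalCoeff p n ((List.ofFn w).map t).prod := by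
    simp only [evalCoeff, subst, List.length_ofFn, Finset.sum_smul, Finset.smul_sum, mul_smul,
      List.map_ofFn, Function.comp_def]
    rw [Finset.sum_comm]
    exact Finset.sum_congr rfl fun m _ => Finset.sum_comm
  rw [key, Finset.sum_eq_single n]
  · simp_rw [← coeff_eval, hprod, List.length_ofFn, PowerSeries.coeff_monomial_same]
    rw [coeff_eval, evalCoeff]
  · intro m _ hm
    refine Finset.sum_eq_zero fun w _ => ?_
    rw [← coeff_eval, hprod, List.length_ofFn, PowerSeries.coeff_monomial, if_neg hm.symm,
      smul_zero]
  · simp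

/-- An evaluation that kills `S` kills the closed ideal generated by `S`. -/
theorem eval_eq_zero_of_mem_closedIdeal (p : X → E) {S : Set (NCSeries X k)}
    (hS : ∀ r ∈ S, eval p r = 0) {f : NCSeries X k} (hf : f ∈ closedIdeal S) : eval p f = 0 := by
  have hf' : ∀ n : ℕ, ∃ g ∈ TwoSidedIdeal.span S,
      ∀ w : List X, w.length ≤ n → f.coeff w = g.coeff w := by
    simpa [closedIdeal, TwoSidedIdeal.mem_mk'] using hf
  ext n
  obtain ⟨g, hg, h⟩ := hf' n
  have hle : TwoSidedIdeal.span S ≤ TwoSidedIdeal.ker (eval p : NCSeries X k →+* _) :=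
    TwoSidedIdeal.span_le.2 fun r hr => (TwoSidedIdeal.mem_ker _).2 (hS r hr)
  rw [coeff_eval, evalCoeff_congr p n h, ← coeff_eval, (TwoSidedIdeal.mem_ker _).1 (hle hg)]

end Eval

/-! ### Group-like series at commuting arguments -/

theorem shuffles_nil_left {X : Type*} (v : List X) : shuffles [] v = [v] := by
  simp [shuffles]

theorem shuffles_nil_right {X : Type*} (u : List X) : shuffles u [] = [u] := by
  cases u <;> simp [shuffles]

section GroupLike

variable {X k E : Type*} [Fintype X] [CommRing k] [Ring E] [Algebra k E]

/-- The component of bidegree `(i, j)` of the coproduct of `f`, evaluated at `p` in the first factor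
and at `q` in the second. -/
def coprodCoeff (p q : X → E) (i j : ℕ) (f : NCSeries X k) : E :=
  ∑ u : Fin i → X, ∑ v : Fin j → X, ((shuffles (List.ofFn u) (List.ofFn v)).map f.coeff).sum •
    (((List.ofFn u).map p).prod * ((List.ofFn v).map q).prod)

theorem coprodCoeff_zero_left (p q : X → E) (j : ℕ) (f : NCSeries X k) :
    coprodCoeff p q 0 j f = evalCoeff q j f := by
  simp [coprodCoeff, evalCoeff, shuffles_nil_left]

theorem coprodCoeff_zero_right (p q : X → E) (i : ℕ) (f : NCSeries X k) :
    coprodCoeff p q i 0 f = evalCoeff p i f := by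
  simp [coprodCoeff, evalCoeff, shuffles_nil_right]

theorem coprodCoeff_succ_succ {p q : X → E} (hpq : ∀ x y, Commute (p x) (q y)) (i j : ℕ)
    (f : NCSeries X k) :
    coprodCoeff p q (i + 1) (j + 1) f =
      ∑ x, p x * coprodCoeff p q i (j + 1) (f.shift x)
        + ∑ x, q x * coprodCoeff p q (i + 1) j (f.shift x) := by
  have hcomm (u : List X) (y : X) : (u.map p).prod * q y = q y * (u.map p).prod := by
    refine (Commute.list_prod_left _ _ fun a ha => ?_).eq
    obtain ⟨x, -, rfl⟩ := List.mem_map.1 ha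
    exact hpq x y
  have hs (x y : X) (u v : List X) :
      ((shuffles (x :: u) (y :: v)).map f.coeff).sum =
        ((shuffles u (y :: v)).map (f.shift x).coeff).sum
          + ((shuffles (x :: u) v).map (f.shift y).coeff).sum := by
    simp [shuffles, shift, Function.comp_def]
  let W (f : NCSeries X k) (u v : List X) : E :=
    ((shuffles u v).map f.coeff).sum • ((u.map p).prod * (v.map q).prod)
  have hW (i j : ℕ) (f : NCSeries X k) : coprodCoeff p q i j f =
    ∑ u : Fin i → X, ∑ v : Fin j → X, W f (List.ofFn u) (List.ofFn v) := rfl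
  have hWc (x y : X) (u v : List X) : W f (x :: u) (y :: v) =
      p x * W (f.shift x) u (y :: v) + q y * W (f.shift y) (x :: u) v := by
    simp only [W, hs, add_smul, mul_smul_comm, List.map_cons, List.prod_cons, mul_assoc]
    congr 2
    rw [← mul_assoc _ (q y), hcomm, mul_assoc, ← mul_assoc (p x), (hpq x y).eq, mul_assoc]
  have hsplit (i j : ℕ) (f : NCSeries X k) : coprodCoeff p q (i + 1) j f =
      ∑ x, ∑ u : Fin i → X, ∑ v : Fin j → X, W f (x :: List.ofFn u) (List.ofFn v) := by
    rw [hW, sum_ofFn_succ i fun u => ∑ v : Fin j → X, W f u (List.ofFn v)]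
  have hsplit' (i j : ℕ) (f : NCSeries X k) : coprodCoeff p q i (j + 1) f =
      ∑ u : Fin i → X, ∑ y, ∑ v : Fin j → X, W f (List.ofFn u) (y :: List.ofFn v) := by
    rw [hW]
    exact Finset.sum_congr rfl fun u _ => sum_ofFn_succ j fun v => W f (List.ofFn u) v
  have hboth : coprodCoeff p q (i + 1) (j + 1) f = ∑ x, ∑ u : Fin i → X, ∑ y, ∑ v : Fin j → X,
      W f (x :: List.ofFn u) (y :: List.ofFn v) := by
    rw [hsplit]
    exact Finset.sum_congr rfl fun x _ => Finset.sum_congr rfl fun u _ =>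
      sum_ofFn_succ j fun v => W f (x :: List.ofFn u) v
  rw [hboth]
  simp only [hWc, Finset.sum_add_distrib, hsplit', hsplit, Finset.mul_sum]
  congr 1
  exact (Finset.sum_congr rfl fun x _ => Finset.sum_comm).trans Finset.sum_comm

theorem evalCoeff_add_eq_sum_coprodCoeff {p q : X → E} (hpq : ∀ x y, Commute (p x) (q y)) (n : ℕ)
    (f : NCSeries X k) :
    evalCoeff (p + q) n f = ∑ ij ∈ antidiagonal n, coprodCoeff p q ij.1 ij.2 f := by
  induction n generalizing f with
  | zero => simp [coprodCoeff_zero_left, evalCoeff_zero]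
  | succ n ih =>
    let P (i j : ℕ) : E := ∑ x, p x * coprodCoeff p q i j (f.shift x)
    let Q (i j : ℕ) : E := ∑ x, q x * coprodCoeff p q i j (f.shift x)
    let P' : ℕ → ℕ → E := fun i j => Nat.casesOn i 0 fun i => P i j
    let Q' : ℕ → ℕ → E := fun i j => Nat.casesOn j 0 fun j => Q i j
    have hsum : ∀ ij ∈ antidiagonal (n + 1),
        coprodCoeff p q ij.1 ij.2 f = P' ij.1 ij.2 + Q' ij.1 ij.2 := by
      rintro ⟨i, j⟩ hij
      rw [HasAntidiagonal.mem_antidiagonal] at hij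
      match i, j with
      | 0, 0 => simp at hij
      | 0, j + 1 => simp [P', Q', Q, coprodCoeff_zero_left, evalCoeff_succ]
      | i + 1, 0 => simp [P', Q', P, coprodCoeff_zero_right, evalCoeff_succ]
      | i + 1, j + 1 => exact coprodCoeff_succ_succ hpq i j f
    rw [Finset.sum_congr rfl hsum, Finset.sum_add_distrib, Finset.Nat.sum_antidiagonal_succ,
      Finset.Nat.sum_antidiagonal_succ' (f := fun ij => Q' ij.1 ij.2), evalCoeff_succ]
    simp only [ih, P', Q', P, Q, Pi.add_apply, add_mul, Finset.sum_add_distrib, Finset.mul_sum]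
    congr 1 <;> exact Finset.sum_comm.trans (zero_add _).symm

/-- The multiplicativity of the evaluation of a group-like series over commuting families: this is
`Δ h = h ⊗ h`. -/
theorem IsGroupLike.eval_add {h : NCSeries X k} (hh : IsGroupLike h) {p q : X → E}
    (hpq : ∀ x y, Commute (p x) (q y)) : eval (p + q) h = eval p h * eval q h := by
  ext n
  simp only [PowerSeries.coeff_mul, coeff_eval, evalCoeff_add_eq_sum_coprodCoeff hpq]
  refine Finset.sum_congr rfl fun ij _ => ?_
  simp only [coprodCoeff, evalCoeff, hh.2, Finset.sum_mul_sum, smul_mul_smul_comm]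

end GroupLike

/-! ### Exponentials -/

section Exp

variable {X k E : Type*} [Fintype X] [CommRing k] [Algebra ℚ k] [Ring E] [Algebra k E]

variable (k) in
/-- The series `∑ zⁿ εⁿ / n!`. The ring `k` provides the inverses of the factorials. -/
noncomputable def expSeries (z : E) : PowerSeries E :=
  PowerSeries.mk fun n => algebraMap ℚ k (n.factorial : ℚ)⁻¹ • z ^ n

theorem coeff_expSeries (n : ℕ) (z : E) :
    PowerSeries.coeff n (expSeries k z) = algebraMap ℚ k (n.factorial : ℚ)⁻¹ • z ^ n :=
  PowerSeries.coeff_mk _ _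

theorem expSeries_zero : expSeries k (0 : E) = 1 := by
  ext n
  rw [coeff_expSeries, PowerSeries.coeff_one]
  cases n <;> simp

theorem expSeries_add {x y : E} (hxy : Commute x y) :
    expSeries k (x + y) = expSeries k x * expSeries k y := by
  ext n
  rw [PowerSeries.coeff_mul, coeff_expSeries, hxy.add_pow', Finset.smul_sum]
  refine Finset.sum_congr rfl fun ij hij => ?_
  rw [HasAntidiagonal.mem_antidiagonal] at hij
  rw [coeff_expSeries, coeff_expSeries, smul_mul_smul_comm, ← Nat.cast_smul_eq_nsmul k, smul_smul,
    ← map_mul, ← map_natCast (algebraMap ℚ k), ← map_mul]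
  congr 2
  have hc : ((ij.1 + ij.2).choose ij.1 : ℚ) * ij.1.factorial * ij.2.factorial =
      (ij.1 + ij.2).factorial := by
    rw [Nat.choose_symm_add]
    exact_mod_cast Nat.add_choose_mul_factorial_mul_factorial ij.1 ij.2
  rw [← hij, ← hc]
  have := Nat.choose_pos (Nat.le_add_right ij.1 ij.2)
  field_simp

theorem expSeries_mul_neg (z : E) : expSeries k z * expSeries k (-z) = 1 := by
  rw [← expSeries_add (Commute.refl z).neg_right, add_neg_cancel, expSeries_zero]

theorem commute_expSeries_eval {z : E} {p : X → E} (hz : ∀ x, Commute z (p x))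
    (h : NCSeries X k) : Commute (expSeries k z) (eval p h) := by
  have hl (l : List X) : Commute z (l.map p).prod :=
    Commute.list_prod_right _ _ fun a ha => by
      obtain ⟨x, -, rfl⟩ := List.mem_map.1 ha
      exact hz x
  have hc (i j : ℕ) : Commute (PowerSeries.coeff i (expSeries k z))
      (PowerSeries.coeff j (eval p h)) := by
    rw [coeff_expSeries, coeff_eval, evalCoeff]
    exact Commute.sum_right _ _ _ fun w _ => (((hl _).pow_left i).smul_left _).smul_right _
  ext n
  rw [PowerSeries.coeff_mul, PowerSeries.coeff_mul, ← Finset.Nat.sum_antidiagonal_swap]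
  exact Finset.sum_congr rfl fun ij _ => hc _ _

theorem monomial_one_pow (z : E) (n : ℕ) :
    PowerSeries.monomial 1 z ^ n = PowerSeries.monomial n (z ^ n) := by
  induction n with
  | zero => simp [PowerSeries.monomial_zero_eq_C_apply]
  | succ n ih => rw [pow_succ, ih, PowerSeries.monomial_mul_monomial, pow_succ]

theorem eval_exp (p : X → E) {f : NCSeries X k} {z : E} (hf : eval p f = PowerSeries.monomial 1 z) :
    eval p (exp f) = expSeries k z := by
  ext n
  have key : evalCoeff p n (exp f) = ∑ m ∈ range (n + 1),
      algebraMap ℚ k (m.factorial : ℚ)⁻¹ • evalCoeff p n (f ^ m) := by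
    simp only [evalCoeff, exp, List.length_ofFn, Finset.sum_smul, Finset.smul_sum]
    rw [Finset.sum_comm]
    simp only [Algebra.smul_def (_ : ℚ), mul_smul]
  rw [coeff_eval, key, coeff_expSeries, Finset.sum_eq_single n]
  · rw [← coeff_eval, map_pow, hf, monomial_one_pow,
      PowerSeries.coeff_monomial_same]
  · intro m _ hm
    rw [← coeff_eval, map_pow, hf, monomial_one_pow, PowerSeries.coeff_monomial,
      if_neg hm.symm, smul_zero]
  · simp

/-- A power series `F` with constant term `1` and `F(2ε) = F(ε)²` is determined by its linear
term. -/
theorem eq_of_doubling {F G : PowerSeries k} (hF : ∀ n, PowerSeries.coeff n (F * F) =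
    2 ^ n * PowerSeries.coeff n F) (hG : ∀ n, PowerSeries.coeff n (G * G) =
    2 ^ n * PowerSeries.coeff n G) (hF0 : PowerSeries.coeff 0 F = 1)
    (hG0 : PowerSeries.coeff 0 G = 1) (h1 : PowerSeries.coeff 1 F = PowerSeries.coeff 1 G) :
    F = G := by
  ext n
  induction n using Nat.strong_induction_on with
  | _ n ih =>
    match n with
    | 0 => rw [hF0, hG0]
    | 1 => exact h1
    | n + 2 =>
      have e1 := hF (n + 2)
      have e2 := hG (n + 2)
      rw [PowerSeries.coeff_mul, Finset.Nat.antidiagonal_succ_succ', Finset.sum_cons,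
        Finset.sum_cons, Finset.sum_map] at e1 e2
      have hmid : ∀ ij ∈ antidiagonal n, PowerSeries.coeff (ij.1 + 1) F *
          PowerSeries.coeff (ij.2 + 1) F =
          PowerSeries.coeff (ij.1 + 1) G * PowerSeries.coeff (ij.2 + 1) G := by
        intro ij hij
        rw [HasAntidiagonal.mem_antidiagonal] at hij
        rw [ih _ (by omega), ih _ (by omega)]
      simp only [Function.Embedding.prodMap, Function.Embedding.coeFn_mk, Prod.map_fst,
        Prod.map_snd, Nat.succ_eq_add_one] at e1 e2
      rw [Finset.sum_congr rfl hmid] at e1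
      rw [hF0] at e1
      rw [hG0] at e2
      have hu : IsUnit ((2 : k) ^ (n + 2) - 2) := by
        have hq : ((2 : ℚ) ^ (n + 2) - 2) ≠ 0 := by
          have : (1 : ℚ) ≤ 2 ^ n := one_le_pow₀ (by norm_num)
          rw [pow_add]
          linarith
        have h2 := (IsUnit.mk0 _ hq).map (algebraMap ℚ k)
        rwa [map_sub, map_pow, map_ofNat] at h2
      refine hu.mul_left_cancel ?_
      linear_combination e2 - e1

/-- A group-like series, evaluated at multiples of a single element, is an exponential. -/
theorem IsGroupLike.eval_smul_const {h : NCSeries X k} (hh : IsGroupLike h) (c : X → k) (z : E) :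
    eval (fun x => c x • z) h = expSeries k ((∑ x, c x * h.coeff [x]) • z) := by
  have hprod (l : List X) : (l.map fun x => c x • z).prod = (l.map c).prod • z ^ l.length := by
    induction l with
    | nil => simp
    | cons x l ih =>
      rw [List.map_cons, List.prod_cons, ih, smul_mul_smul_comm, List.map_cons, List.prod_cons,
        List.length_cons, pow_succ']
  have hscal (n : ℕ) : evalCoeff (fun x => c x • z) n h = evalCoeff c n h • z ^ n := by
    simp only [evalCoeff, hprod, List.length_ofFn, Finset.sum_smul, smul_smul, smul_eq_mul]
  have hone : eval c h = expSeries k (∑ x, c x * h.coeff [x]) := by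
    refine eq_of_doubling (fun n => ?_) (fun n => ?_) ?_ ?_ ?_
    · rw [← hh.eval_add fun _ _ => Commute.all _ _, coeff_eval, coeff_eval]
      have h2 (l : List X) : (l.map (c + c)).prod = 2 ^ l.length * (l.map c).prod := by
        induction l with
        | nil => simp
        | cons x l ih => simp [ih, pow_succ]; ring
      simp only [evalCoeff, h2, List.length_ofFn, Finset.mul_sum, smul_eq_mul]
      exact Finset.sum_congr rfl fun _ _ => mul_left_comm _ _ _
    · rw [← expSeries_add (Commute.refl _), coeff_expSeries, coeff_expSeries, ← two_mul, mul_pow,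
        smul_eq_mul, smul_eq_mul, mul_left_comm]
    · simp [coeff_eval, evalCoeff_zero, hh.1]
    · simp [coeff_expSeries]
    · simp [coeff_expSeries, coeff_eval, evalCoeff_succ, evalCoeff_zero, shift]
  ext n
  rw [coeff_eval, hscal, ← coeff_eval, hone, coeff_expSeries, coeff_expSeries, smul_pow, smul_smul,
    smul_eq_mul]

/-- Adding multiples of an element that commutes with the arguments of a group-like series. -/
theorem IsGroupLike.eval_add_smul_const {h : NCSeries X k} (hh : IsGroupLike h) (p : X → E)
    (c : X → k) (z : E) (hz : ∀ x, Commute z (p x)) :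
    eval (fun x => p x + c x • z) h = eval p h * expSeries k ((∑ x, c x * h.coeff [x]) • z) := by
  rw [← hh.eval_smul_const, ← hh.eval_add fun x y => ((hz x).smul_left (c y)).symm]
  rfl

end Exp

/-! ### Invertible series -/

section Unit

variable {X k : Type*} [CommRing k]

theorem coeff_mul_congr {f g f' g' : NCSeries X k} {w : List X}
    (hf : ∀ u : List X, u.length ≤ w.length → f.coeff u = f'.coeff u)
    (hg : ∀ u : List X, u.length ≤ w.length → g.coeff u = g'.coeff u) :
    (f * g).coeff w = (f' * g').coeff w := by
  rw [coeff_mul, coeff_mul]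
  refine Finset.sum_congr rfl fun i _ => ?_
  rw [hf _ (by simp), hg _ (by simp)]

theorem coeff_pow_eq_zero {u : NCSeries X k} (hu : u.coeff [] = 0) (n : ℕ) (w : List X)
    (hw : w.length < n) : (u ^ n).coeff w = 0 := by
  induction n generalizing w with
  | zero => simp at hw
  | succ n ih =>
    rw [pow_succ', coeff_mul]
    refine Finset.sum_eq_zero fun i hi => ?_
    cases i with
    | zero => simp [hu]
    | succ i =>
      rw [ih, mul_zero]
      rw [Finset.mem_range] at hi
      simp only [List.length_drop]
      omega

/-- A series with constant term `1` is invertible: its inverse is the geometric series. -/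
theorem isUnit_of_coeff_nil_eq_one {f : NCSeries X k} (hf : f.coeff [] = 1) : IsUnit f := by
  have hu : (1 - f).coeff [] = 0 := by simp [hf]
  have hsum (N : ℕ) (w : List X) : (∑ n ∈ range N, (1 - f) ^ n : NCSeries X k).coeff w =
      ∑ n ∈ range N, ((1 - f) ^ n).coeff w := by
    induction N with
    | zero => simp
    | succ N ih => rw [Finset.sum_range_succ, Finset.sum_range_succ, coeff_add, ih]
  let g : NCSeries X k := ⟨fun w => ∑ n ∈ range (w.length + 1), ((1 - f) ^ n).coeff w⟩
  have hg (w v : List X) (hv : v.length ≤ w.length) :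
      g.coeff v = (∑ n ∈ range (w.length + 1), (1 - f) ^ n : NCSeries X k).coeff v := by
    rw [hsum]
    refine Finset.sum_subset (Finset.range_subset_range.2 (by omega)) fun n _ hn => ?_
    rw [Finset.mem_range, not_lt] at hn
    exact coeff_pow_eq_zero hu n v hn
  refine isUnit_iff_exists.2 ⟨g, ?_, ?_⟩
  · ext w
    rw [coeff_mul_congr (fun _ _ => rfl) (hg w)]
    have := mul_neg_geom_sum (1 - f) (w.length + 1)
    rw [sub_sub_cancel] at this
    rw [this, coeff_sub, coeff_pow_eq_zero hu _ w (Nat.lt_succ_self _), sub_zero]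
  · ext w
    rw [coeff_mul_congr (hg w) fun _ _ => rfl]
    have := geom_sum_mul_neg (1 - f) (w.length + 1)
    rw [sub_sub_cancel] at this
    rw [this, coeff_sub, coeff_pow_eq_zero hu _ w (Nat.lt_succ_self _), sub_zero]

theorem isUnit_subst {X Y : Type*} [Fintype X] (t : X → NCSeries Y k) {h : NCSeries X k}
    (hh : h.coeff [] = 1) : IsUnit (subst t h) :=
  isUnit_of_coeff_nil_eq_one (by simp [subst, hh])

end Unit

end NCSeries

namespace Cyclotomic

open NCSeries

/-! ### The mixed pentagon equation in an algebra -/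

noncomputable instance (m N : ℕ) [NeZero N] : Fintype (Gen m N) :=
  Fintype.ofInjective
    (fun
      | .pole j => Sum.inl j
      | .chord a i j _ => Sum.inr (a, i, j) :
        Gen m N → Fin m ⊕ (ZMod N × Fin (m + 1) × Fin (m + 1)))
    (by
      rintro (_ | _) (_ | _) h <;> simp_all)

/-- The evaluation of a series in `e⁰, e¹, e⁻¹` at three elements. -/
noncomputable abbrev eval3 {k E : Type*} [CommRing k] [Ring E] [Algebra k E] (x y z : E) :
    NCSeries (Gen3 2) k →+* PowerSeries E :=
  eval fun o => o.elim x ![y, z]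

/-- A representation of `𝔱⁰_{4,2}` in a ring: images `t12`, `t13` of the `t^{1j}`, and images
`pij`, `mij` of `t(0)^{ij}`, `t(1)^{ij}`, which satisfy the defining relations. -/
structure BraidRep (E : Type*) [Ring E] where
  (t12 t13 p23 m23 p24 m24 p34 m34 : E)
  p23_p : Commute p23 (p24 + p34)
  p23_m : Commute p23 (m24 + m34)
  m23_p : Commute m23 (p24 + m34)
  m23_m : Commute m23 (m24 + p34)
  p24_p : Commute p24 (p23 + p34)
  p24_m : Commute p24 (m23 + m34)
  m24_p : Commute m24 (p23 + m34)
  m24_m : Commute m24 (m23 + p34)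
  p34_p : Commute p34 (p23 + p24)
  p34_m : Commute p34 (m23 + m24)
  m34_p : Commute m34 (p23 + m24)
  m34_m : Commute m34 (m23 + p24)
  p23_t : Commute p23 (t12 + t13 + (p23 + m23))
  m23_t : Commute m23 (t12 + t13 + (p23 + m23))
  t12_t13 : Commute t12 (t13 + (p23 + m23))
  t13_t12 : Commute t13 (t12 + (p23 + m23))
  t12_p34 : Commute t12 p34
  t12_m34 : Commute t12 m34
  t13_p24 : Commute t13 p24
  t13_m24 : Commute t13 m24

namespace BraidRep

section

variable {E : Type*} [Ring E] (ρ : BraidRep E)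

/-- The image of `t^{1,j+2}`. -/
def pole (j : Fin 2) : E := ![ρ.t12, ρ.t13] j

/-- The image of `t(a)^{i+2,j+2}`, and `0` for `i = j`. -/
def chord (a : ZMod 2) (i j : Fin 3) : E :=
  if a = 0 then !![0, ρ.p23, ρ.p24; ρ.p23, 0, ρ.p34; ρ.p24, ρ.p34, 0] i j
  else !![0, ρ.m23, ρ.m24; ρ.m23, 0, ρ.m34; ρ.m24, ρ.m34, 0] i j

/-- The images of the generators. -/
def gen : Gen 2 2 → E
  | .pole j => ρ.pole j
  | .chord a i j _ => ρ.chord a i j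

theorem chord_symm (a : ZMod 2) (i j : Fin 3) : ρ.chord (-a) j i = ρ.chord a i j := by
  rw [ZMod.neg_eq_self_mod_two]
  fin_cases i <;> fin_cases j <;> rfl

theorem commute_triangle (a b : ZMod 2) (i j l : Fin 3) (hij : i ≠ j) (hil : i ≠ l) (hjl : j ≠ l) :
    Commute (ρ.chord a i j) (ρ.chord (a + b) i l + ρ.chord b j l) := by
  have h2 : (1 : ZMod 2) + 1 = 0 := rfl
  have ha : a = 0 ∨ a = 1 := by revert a; decide
  have hb : b = 0 ∨ b = 1 := by revert b; decide
  have := ρ.p23_p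
  have := ρ.p23_m
  have := ρ.m23_p
  have := ρ.m23_m
  have := ρ.p24_p
  have := ρ.p24_m
  have := ρ.m24_p
  have := ρ.m24_m
  have := ρ.p34_p
  have := ρ.p34_m
  have := ρ.m34_p
  have := ρ.m34_m
  rcases ha with rfl | rfl <;> rcases hb with rfl | rfl <;> fin_cases i <;> fin_cases j <;>
    fin_cases l <;> first
    | exact absurd rfl hij
    | exact absurd rfl hil
    | exact absurd rfl hjl
    | (simp [chord, h2]; first | assumption | (rw [add_comm]; assumption))

end

section

variable {k E : Type*} [CommRing k] [Ring E] [Algebra k E] (ρ : BraidRep E)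

theorem eval_tp (j : Fin 2) :
    eval ρ.gen (tp j : NCSeries (Gen 2 2) k) = PowerSeries.monomial 1 (ρ.pole j) :=
  eval_var _ _

theorem eval_tc (a : ZMod 2) (i j : Fin 3) :
    eval ρ.gen (tc a i j : NCSeries (Gen 2 2) k) = PowerSeries.monomial 1 (ρ.chord a i j) := by
  by_cases h : i = j
  · subst h
    have : ρ.chord a i i = 0 := by fin_cases i <;> simp [chord]
    simp [tc, this]
  · rw [tc, dif_pos h, eval_var]
    rfl

theorem eval_tcSum (i j : Fin 3) : eval ρ.gen (tcSum i j : NCSeries (Gen 2 2) k) =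
    PowerSeries.monomial 1 (ρ.chord 0 i j + ρ.chord 1 i j) := by
  have h : (tcSum i j : NCSeries (Gen 2 2) k) = tc 0 i j + tc 1 i j := Fin.sum_univ_two _
  rw [h, map_add, eval_tc, eval_tc, map_add]

theorem eval_ringComm {f g : NCSeries (Gen 2 2) k} {x y : E}
    (hf : eval ρ.gen f = PowerSeries.monomial 1 x) (hg : eval ρ.gen g = PowerSeries.monomial 1 y)
    (h : Commute x y) : eval ρ.gen (ringComm f g) = 0 := by
  rw [ringComm, map_sub, map_mul, map_mul, hf, hg, PowerSeries.monomial_mul_monomial,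
    PowerSeries.monomial_mul_monomial, h.eq, sub_self]

theorem eval_relation {r : NCSeries (Gen 2 2) k} (hr : Relation 2 2 k r) : eval ρ.gen r = 0 := by
  cases hr with
  | symm a i j hij => rw [map_sub, eval_tc, eval_tc, chord_symm, sub_self]
  | triangle a b i j l hij hil hjl =>
    refine ρ.eval_ringComm (ρ.eval_tc _ _ _) ?_ (ρ.commute_triangle a b i j l hij hil hjl)
    rw [map_add, eval_tc, eval_tc, map_add]
  | poles_chord a i j hij =>
    refine ρ.eval_ringComm (x := ρ.pole i + ρ.pole j +
      (ρ.chord 0 i.castSucc j.castSucc + ρ.chord 1 i.castSucc j.castSucc)) ?_ (ρ.eval_tc _ _ _) ?_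
    · rw [map_add, map_add, eval_tp, eval_tp, eval_tcSum, ← map_add, ← map_add]
    · have ha : a = 0 ∨ a = 1 := by revert a; decide
      have h1 := ρ.p23_t.symm
      have h2 := ρ.m23_t.symm
      rcases ha with rfl | rfl <;> fin_cases i <;> fin_cases j <;> first
        | exact absurd rfl hij
        | (simp [chord, pole]; first | assumption | (rw [add_comm ρ.t13]; assumption))
  | pole_pole i j hij =>
    refine ρ.eval_ringComm (ρ.eval_tp _) (y := ρ.pole j +
      (ρ.chord 0 i.castSucc j.castSucc + ρ.chord 1 i.castSucc j.castSucc)) ?_ ?_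
    · rw [map_add, eval_tp, eval_tcSum, ← map_add]
    · have h1 := ρ.t12_t13
      have h2 := ρ.t13_t12
      fin_cases i <;> fin_cases j <;> first
        | exact absurd rfl hij
        | (simp [chord, pole]; assumption)
  | pole_chord a i j l hij hil hjl =>
    refine ρ.eval_ringComm (ρ.eval_tp _) (ρ.eval_tc _ _ _) ?_
    have ha : a = 0 ∨ a = 1 := by revert a; decide
    have h1 := ρ.t12_p34
    have h2 := ρ.t12_m34
    have h3 := ρ.t13_p24
    have h4 := ρ.t13_m24
    rcases ha with rfl | rfl <;> fin_cases i <;> fin_cases j <;> fin_cases l <;> first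
      | exact absurd rfl hij
      | exact absurd rfl hil
      | exact absurd rfl hjl
      | (simp [chord, pole]; assumption)
  | chord_chord a b i j l p hij hil hip hjl hjp hlp => omega

theorem eval_eq_of_toUHat_eq {f g : NCSeries (Gen 2 2) k}
    (h : (toUHat f : UHat 2 2 k) = toUHat g) : eval ρ.gen f = eval ρ.gen g := by
  have h1 : f - g ∈ relationIdeal 2 2 k := by
    rw [← TwoSidedIdeal.rel_iff]
    exact (RingCon.eq _).1 h
  rw [← sub_eq_zero, ← map_sub]
  exact eval_eq_zero_of_mem_closedIdeal _ (fun r hr => ρ.eval_relation hr) h1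

theorem eval_subst3 {t : Gen3 2 → NCSeries (Gen 2 2) k} {x y z : E}
    (h0 : eval ρ.gen (t none) = PowerSeries.monomial 1 x)
    (h1 : eval ρ.gen (t (some 0)) = PowerSeries.monomial 1 y)
    (h2 : eval ρ.gen (t (some 1)) = PowerSeries.monomial 1 z) (h : NCSeries (Gen3 2) k) :
    eval ρ.gen (subst t h) = eval3 x y z h := by
  refine eval_subst _ _ _ (fun o => ?_) h
  match o with
  | none => exact h0
  | some 0 => exact h1
  | some 1 => exact h2

/-- The associator `g = δ(h)` is evaluated at `x, y` as `h(x, y, 0)`. -/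
theorem eval_subst_delta {t : Gen3 1 → NCSeries (Gen 2 2) k} {x y : E}
    (h0 : eval ρ.gen (t none) = PowerSeries.monomial 1 x)
    (h1 : eval ρ.gen (t (some 0)) = PowerSeries.monomial 1 y) (h : NCSeries (Gen3 2) k) :
    eval ρ.gen (subst t (delta h)) = eval3 x y 0 h := by
  rw [eval_subst ρ.gen (fun o : Gen3 1 => o.elim x fun _ => y) t]
  · refine eval_subst _ _ _ (fun o => ?_) h
    match o with
    | none => exact eval_var _ _
    | some 0 => exact eval_var _ _
    | some 1 => exact (map_zero _).trans (map_zero _).symm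
  · intro o
    match o with
    | none => exact h0
    | some 0 => exact h1

/-- The mixed pentagon equation in a representation of `𝔱⁰_{4,2}`. -/
theorem mixedPentagon [Algebra ℚ k] {h : NCSeries (Gen3 2) k} (hh : MixedPentagon (delta h) h) :
    eval3 ρ.t12 (ρ.p23 + ρ.p24) (ρ.m23 + ρ.m24) h
        * eval3 (ρ.t13 + (ρ.p23 + ρ.m23)) ρ.p34 ρ.m34 h =
      eval3 ρ.p23 ρ.p34 0 h
        * eval3 (ρ.t12 + ρ.t13 + (ρ.p23 + ρ.m23)) (ρ.p24 + ρ.p34) (ρ.m24 + ρ.m34) h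
        * eval3 ρ.t12 ρ.p23 ρ.m23 h := by
  have key := hh
  simp only [MixedPentagon, insertCyc, insertOne, toUHat, ← map_mul] at key
  have key2 := ρ.eval_eq_of_toUHat_eq key
  simp only [map_mul] at key2
  have htc (i : Fin 3) : (tcSum i i : NCSeries (Gen 2 2) k) = 0 := by simp [tcSum, tc]
  have f0 : ({j : Fin 2 | j.castSucc ∈ ({0} : Finset (Fin 3))} : Finset (Fin 2)) = {0} := by decide
  have f1 : ({j : Fin 2 | j.castSucc ∈ ({1} : Finset (Fin 3))} : Finset (Fin 2)) = {1} := by decide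
  have f01 : ({j : Fin 2 | j.castSucc ∈ ({0, 1} : Finset (Fin 3))} : Finset (Fin 2)) = {0, 1} := by
    decide
  have h12 : (1 : Fin 3) ≠ 2 := by decide
  have h01 (f : Fin 3 → NCSeries (Gen 2 2) k) : ∑ i ∈ {0, 1}, f i = f 0 + f 1 :=
    Finset.sum_pair (by decide)
  have h01' (f : Fin 2 → NCSeries (Gen 2 2) k) : ∑ i ∈ {0, 1}, f i = f 0 + f 1 :=
    Finset.sum_pair (by decide)
  have hhalf (f : NCSeries (Gen 2 2) k) : eval ρ.gen ((2⁻¹ : ℚ) • f) =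
      algebraMap ℚ k 2⁻¹ • eval ρ.gen f := by
    rw [← eval_smul]
    congr 1
    ext w
    simp [Algebra.smul_def]
  have hadd (a : PowerSeries E) : algebraMap ℚ k 2⁻¹ • a + algebraMap ℚ k 2⁻¹ • a = a := by
    rw [← add_smul, ← map_add]
    norm_num
  refine (congrArg₂ (· * ·) (ρ.eval_subst3 ?_ ?_ ?_ h) (ρ.eval_subst3 ?_ ?_ ?_ h)).symm.trans
    (key2.trans (congrArg₂ (· * ·) (congrArg₂ (· * ·) (ρ.eval_subst_delta ?_ ?_ h)
      (ρ.eval_subst3 ?_ ?_ ?_ h)) (ρ.eval_subst3 ?_ ?_ ?_ h)))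
  all_goals
    simp only [f0, f1, f01, one_div, sum_singleton, sum_empty, htc, h01, h01', smul_zero, add_zero,
      Finset.sum_pair h12, map_add, hhalf, eval_tp, eval_tc, eval_tcSum]
    simp [pole, chord, ← add_assoc]
  -- Only the sum of `t^{ij}` over the ordered pairs from `B = {2, 3}` is left.
  conv_rhs => rw [← hadd (PowerSeries.monomial 1 ρ.p23), ← hadd (PowerSeries.monomial 1 ρ.m23)]
  abel

end

end BraidRep

/-! ### Consequences of the mixed pentagon equation -/

theorem coeff_one_eval3 {k : Type*} [CommRing k] {h : NCSeries (Gen3 2) k} (x y z : k) :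
    PowerSeries.coeff 1 (eval3 x y z h) =
    x * h.coeff [none] + (y * h.coeff [some 0] + z * h.coeff [some 1]) := by
  have h1 : (Finset.univ : Finset (ZMod 2)) = {0, 1} := rfl
  rw [coeff_eval, evalCoeff_succ, Fintype.sum_option, h1, Finset.sum_pair (by decide)]
  simp only [evalCoeff_zero, shift]
  rfl

section

variable {k E : Type*} [CommRing k] [Algebra ℚ k] [Ring E] [Algebra k E]
  {h : NCSeries (Gen3 2) k}

theorem isUnit_eval3 (hh : h ∈ PENT 2 k) (x y z : E) : IsUnit (eval3 x y z h) :=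
  (isUnit_of_coeff_nil_eq_one hh.1.1).map _

/-- The pentagon under the character `t12 ↦ 1` reads `u = u²` with `u = h(ε, 0, 0)` invertible. -/
theorem coeff_none_eq_zero (hh : h ∈ PENT 2 k) : h.coeff [none] = 0 := by
  let ρ : BraidRep k := by refine ⟨1, 0, 0, 0, 0, 0, 0, 0, ?_, ?_, ?_, ?_, ?_, ?_, ?_, ?_, ?_, ?_,
    ?_, ?_, ?_, ?_, ?_, ?_, ?_, ?_, ?_, ?_⟩ <;> exact Commute.all _ _
  have key := ρ.mixedPentagon hh.2
  simp only [ρ, add_zero] at key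
  rw [mul_comm, mul_assoc] at key
  have h1 := (isUnit_eval3 hh (1 : k) 0 0).mul_eq_left.1
    ((isUnit_eval3 hh (0 : k) 0 0).mul_left_cancel key).symm
  simpa [coeff_one_eval3, PowerSeries.coeff_one] using congrArg (PowerSeries.coeff 1) h1

/-- The pentagon under the character `t(0)^{34} ↦ 1` reads `u = u²` with `u = h(0, ε, 0)`
invertible. -/
theorem coeff_some_zero_eq_zero (hh : h ∈ PENT 2 k) : h.coeff [some 0] = 0 := by
  let ρ : BraidRep k := by refine ⟨0, 0, 0, 0, 0, 0, 1, 0, ?_, ?_, ?_, ?_, ?_, ?_, ?_, ?_, ?_, ?_,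
    ?_, ?_, ?_, ?_, ?_, ?_, ?_, ?_, ?_, ?_⟩ <;> exact Commute.all _ _
  have key := ρ.mixedPentagon hh.2
  simp only [ρ, add_zero, zero_add] at key
  rw [mul_comm] at key
  have h1 := (isUnit_eval3 hh (0 : k) 1 0).mul_eq_left.1
    ((isUnit_eval3 hh (0 : k) 0 0).mul_right_cancel key).symm
  simpa [coeff_one_eval3, PowerSeries.coeff_one] using congrArg (PowerSeries.coeff 1) h1

/-- Since the coefficients of `e⁰` and `e¹` vanish, only the multiple of `z` that is added to `e⁻¹`
matters. -/
theorem eval3_add_smul (hh : h ∈ PENT 2 k) {x y w z : E} (hx : Commute z x) (hy : Commute z y)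
    (hw : Commute z w) (a b c : k) :
    eval3 (x + a • z) (y + b • z) (w + c • z) h =
      eval3 x y w h * expSeries k ((c * coeffNegOne h) • z) := by
  have h1 : (Finset.univ : Finset (ZMod 2)) = {0, 1} := rfl
  have key := hh.1.eval_add_smul_const (fun o : Gen3 2 => o.elim x ![y, w])
    (fun o => o.elim a ![b, c]) z (fun o => by
      match o with
      | none => exact hx
      | some 0 => exact hy
      | some 1 => exact hw)
  rw [Fintype.sum_option, h1, Finset.sum_pair (by decide)] at key
  simp only [coeff_none_eq_zero hh, coeff_some_zero_eq_zero hh, mul_zero, zero_add] at key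
  refine (congrArg (fun p : Gen3 2 → E => eval p h) (funext fun o => ?_)).trans key
  match o with
  | none => rfl
  | some 0 => rfl
  | some 1 => rfl

/-- The value of `h` at multiples of a single element. -/
theorem eval3_smul (hh : h ∈ PENT 2 k) (z : E) (a b c : k) :
    eval3 (a • z) (b • z) (c • z) h = expSeries k ((c * coeffNegOne h) • z) := by
  have h0 : eval3 (0 : E) 0 0 h = 1 := by
    have := hh.1.eval_smul_const (E := E) (fun o => o.elim 0 ![0, 0]) 0
    rw [smul_zero, expSeries_zero] at this
    refine (congrArg (fun p : Gen3 2 → E => eval p h) (funext fun o => ?_)).trans this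
    match o with
    | none => exact (smul_zero _).symm
    | some 0 => exact (smul_zero _).symm
    | some 1 => exact (smul_zero _).symm
  have := eval3_add_smul hh (Commute.zero_right z) (Commute.zero_right z) (Commute.zero_right z)
    a b c
  rwa [h0, one_mul, zero_add, zero_add, zero_add] at this

/-- The duality relation modulo `e⁰`. -/
theorem eval3_zero_mul_eval3 (hh : h ∈ PENT 2 k) (x y : E) :
    eval3 0 x y h * eval3 x 0 (-x - y) h = expSeries k (-(coeffNegOne h • x)) := by
  -- The residues of the logarithmic derivatives of the members `z₂(z₃ - z₄)`, `z₃(z₂ + z₄)`,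
  -- `z₄(z₂ + z₃)` of a pencil of conics, with values `x`, `y`, `-x - y`.
  let ρ : BraidRep E := by
    refine ⟨x, y, 0, -x - y, 0, y, x, 0, ?_, ?_, ?_, ?_, ?_, ?_, ?_, ?_, ?_, ?_,
    ?_, ?_, ?_, ?_, ?_, ?_, ?_, ?_, ?_, ?_⟩ <;> simp only [Commute, SemiconjBy] <;> noncomm_ring
  have key := ρ.mixedPentagon hh.2
  have e1 : eval3 x 0 (-x) h = expSeries k (-(coeffNegOne h • x)) := by
    simpa using eval3_smul hh x 1 0 (-1)
  have e2 : eval3 (-x) x 0 h = 1 := by simpa [expSeries_zero] using eval3_smul hh x (-1) 1 0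
  have e3 : eval3 0 x 0 h = 1 := by simpa [expSeries_zero] using eval3_smul hh x 0 1 0
  have r1 : -x - y + y = -x := by abel
  have r2 : y + (0 + (-x - y)) = -x := by abel
  have r3 : x + y + (0 + (-x - y)) = 0 := by abel
  simp only [ρ, r1, r2, r3] at key
  rw [add_zero, zero_add, add_zero, e1, e2, e3, mul_one, one_mul] at key
  exact key.symm

/-- The duality relation for the associator `h(x, y, 0)`. -/
theorem eval3_mul_eval3_swap (hh : h ∈ PENT 2 k) (x y : E) :
    eval3 x y 0 h * eval3 y x 0 h = 1 := by
  -- The pencil of conics with the members `z₂(z₃ - z₄)`, `z₃(z₂ - z₄)`, `z₄(z₂ - z₃)`.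
  let ρ : BraidRep E := by
    refine ⟨y, -x - y, x, 0, -x - y, 0, y, 0, ?_, ?_, ?_, ?_, ?_, ?_, ?_, ?_, ?_, ?_,
    ?_, ?_, ?_, ?_, ?_, ?_, ?_, ?_, ?_, ?_⟩ <;> simp only [Commute, SemiconjBy] <;> noncomm_ring
  have key := ρ.mixedPentagon hh.2
  have e1 : eval3 y (-y) 0 h = 1 := by simpa [expSeries_zero] using eval3_smul hh y 1 (-1) 0
  have e2 : eval3 (-y) y 0 h = 1 := by simpa [expSeries_zero] using eval3_smul hh y (-1) 1 0
  have e3 : eval3 0 (-x) 0 h = 1 := by simpa [expSeries_zero] using eval3_smul hh x 0 (-1) 0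
  have r1 : x + (-x - y) = -y := by abel
  have r2 : -x - y + (x + 0) = -y := by abel
  have r3 : y + (-x - y) + (x + 0) = 0 := by abel
  have r4 : -x - y + y = -x := by abel
  simp only [ρ, r1, r2, r3, r4] at key
  rw [add_zero, e1, e2, e3, mul_one, mul_one] at key
  exact key.symm

/-- Duality for a family `s, y, z` that can be completed to a representation of the Lie algebra of
the configuration space of two points of `ℙ¹ ∖ {1, -1, ∞}`. -/
theorem eval3_duality (hh : h ∈ PENT 2 k) {s b c y z : E} (hsy : Commute s (b + y))
    (hsz : Commute s (c + z)) (hby : Commute b (s + y)) (hbz : Commute b z) (hcy : Commute c y)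
    (hcz : Commute c (s + z)) :
    eval3 s y z h * expSeries k (coeffNegOne h • s) * eval3 y s (-s - y - z) h =
      expSeries k (-(coeffNegOne h • y)) := by
  set α := coeffNegOne h with hα
  have hyb : Commute y (b + s) := by
    have h1 := hsy.eq
    have h2 := hby.eq
    simp only [Commute, SemiconjBy]
    linear_combination (norm := noncomm_ring) -h1 - h2
  have hzc : Commute z (c + s) := by
    have h1 := hsz.eq
    have h2 := hcz.eq
    simp only [Commute, SemiconjBy]
    linear_combination (norm := noncomm_ring) -h1 - h2
  -- The strand `1` is forgotten, and `t(1)^{23}` is killed.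
  have E1 : eval3 0 (s + b) c h * eval3 s y z h =
      eval3 s y 0 h * eval3 0 (b + y) (c + z) h := by
    let ρ : BraidRep E :=
      { t12 := 0, t13 := 0, p23 := s, m23 := 0, p24 := b, m24 := c, p34 := y, m34 := z
        p23_p := hsy
        p23_m := hsz
        m23_p := Commute.zero_left _
        m23_m := Commute.zero_left _
        p24_p := hby
        p24_m := by simpa using hbz
        m24_p := hcz
        m24_m := by simpa using hcy
        p34_p := by rwa [add_comm]
        p34_m := by simpa using hcy.symm
        m34_p := by rwa [add_comm]
        m34_m := by simpa using hbz.symm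
        p23_t := by simp
        m23_t := Commute.zero_left _
        t12_t13 := Commute.zero_left _
        t13_t12 := Commute.zero_left _
        t12_p34 := Commute.zero_left _
        t12_m34 := Commute.zero_left _
        t13_p24 := Commute.zero_left _
        t13_m24 := Commute.zero_left _ }
    have key := ρ.mixedPentagon hh.2
    simp only [ρ, add_zero, zero_add] at key
    have e1 : eval3 0 s 0 h = 1 := by simpa [expSeries_zero] using eval3_smul hh s 0 1 0
    have e2 : eval3 s (b + y) (c + z) h = eval3 0 (b + y) (c + z) h := by
      simpa [expSeries_zero] using eval3_add_smul hh (Commute.zero_right s) hsy hsz 1 0 0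
    rw [key, e1, e2, mul_one]
  -- The composite of the previous representation with the automorphism induced by
  -- `z₂ ↦ (1 - z₃) / (1 + z₃)`, `z₃ ↦ (1 - z₂) / (1 + z₂)` in the chart `z₁ = 0`, `z₄ = 1`.
  have E2 : eval3 y s (-s - y - z) h * eval3 (s + b) 0 (-(s + b) - c) h =
      eval3 (b + y) 0 (-(b + y) - (c + z)) h * expSeries k (-(α • s) + -(α • s))
        * eval3 y s 0 h := by
    let ρ : BraidRep E :=
      { t12 := y, t13 := b, p23 := s, m23 := 0, p24 := 0, m24 := -s - y - z, p34 := 0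
        m34 := -(s + b) - c
        p23_p := by simp
        p23_m := by
          simp only [Commute, SemiconjBy]
          linear_combination (norm := noncomm_ring) -hsy.eq - hsz.eq
        m23_p := Commute.zero_left _
        m23_m := Commute.zero_left _
        p24_p := Commute.zero_left _
        p24_m := Commute.zero_left _
        m24_p := by
          simp only [Commute, SemiconjBy]
          linear_combination (norm := noncomm_ring) -hby.eq - hcz.eq - hbz.eq - hcy.eq
        m24_m := by simp
        p34_p := Commute.zero_left _
        p34_m := Commute.zero_left _
        m34_p := by
          simp only [Commute, SemiconjBy]
          linear_combination (norm := noncomm_ring) -hyb.eq - hzc.eq + hbz.eq + hcy.eq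
        m34_m := by simp
        p23_t := by
          simp only [Commute, SemiconjBy]
          linear_combination (norm := noncomm_ring) hsy.eq
        m23_t := Commute.zero_left _
        t12_t13 := by rwa [add_zero]
        t13_t12 := by rwa [add_zero, add_comm]
        t12_p34 := Commute.zero_right _
        t12_m34 := by
          simp only [Commute, SemiconjBy]
          linear_combination (norm := noncomm_ring) hcy.eq - hyb.eq
        t13_p24 := Commute.zero_right _
        t13_m24 := by
          simp only [Commute, SemiconjBy]
          linear_combination (norm := noncomm_ring) -hby.eq - hbz.eq }
    have key := ρ.mixedPentagon hh.2
    simp only [ρ, add_zero, zero_add] at key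
    have e1 : eval3 s 0 0 h = 1 := by simpa [expSeries_zero] using eval3_smul hh s 1 0 0
    have e2 : eval3 (y + b + s) 0 (-s - y - z + (-(s + b) - c)) h =
        eval3 (b + y) 0 (-(b + y) - (c + z)) h * expSeries k (-(α • s) + -(α • s)) := by
      have := eval3_add_smul hh (w := -(b + y) - (c + z)) hsy (Commute.zero_right s)
        (hsy.neg_right.sub_right hsz) 1 0 (-2)
      rw [← hα] at this
      convert! this using 3
      · module
      · simp
      · module
      · module
    rw [e1, e2, one_mul, add_comm b s] at key
    exact key
  have E3 := eval3_zero_mul_eval3 hh (b + y) (c + z)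
  have E4 := eval3_zero_mul_eval3 hh (s + b) c
  have E5 := eval3_mul_eval3_swap hh s y
  rw [← hα] at E3 E4
  -- `s` commutes with the arguments `b + y`, `c + z`, and `s + b + y` with `s`, `y`.
  have C1 : Commute (expSeries k (α • s)) (eval3 (b + y) 0 (-(b + y) - (c + z)) h) := by
    refine commute_expSeries_eval (fun o => ?_) h
    match o with
    | none => exact hsy.smul_left _
    | some 0 => exact Commute.zero_right _
    | some 1 => exact (hsy.neg_right.sub_right hsz).smul_left _
  have C2 : Commute (expSeries k (-(α • (s + b + y)))) (eval3 y s 0 h) := by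
    refine commute_expSeries_eval (fun o => ?_) h
    match o with
    | none =>
      refine ((Commute.smul_left ?_ _)).neg_left
      rw [add_comm s b]
      exact hyb.symm.add_left (Commute.refl y)
    | some 0 =>
      refine ((Commute.smul_left ?_ _)).neg_left
      rw [add_assoc]
      exact (Commute.refl s).add_left hsy.symm
    | some 1 => exact Commute.zero_right _
  have hysb : Commute y (s + b) := by rwa [add_comm]
  have C3 : Commute (expSeries k (-(α • y))) (eval3 0 (s + b) c h) := by
    refine commute_expSeries_eval (fun o => ?_) h
    match o with
    | none => exact Commute.zero_right _
    | some 0 => exact (hysb.smul_left _).neg_left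
    | some 1 => exact (hcy.symm.smul_left _).neg_left
  have X1 : expSeries k (-(α • (b + y))) * (expSeries k (α • s) *
      expSeries k (-(α • s) + -(α • s))) = expSeries k (-(α • (s + b + y))) := by
    have hs : Commute (α • s) (-(α • s)) := (Commute.refl _).neg_right
    rw [← expSeries_add (hs.add_right hs), ← expSeries_add]
    · congr 1
      module
    · rw [add_neg_cancel_left]
      exact (((hsy.symm.smul_left _).smul_right _).neg_left).neg_right
  have X2 : expSeries k (-(α • (s + b + y))) =
      expSeries k (-(α • y)) * expSeries k (-(α • (s + b))) := by
    rw [← expSeries_add (((hysb.smul_left _).smul_right _).neg_left).neg_right]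
    congr 1
    module
  refine (isUnit_eval3 hh 0 (s + b) c).mul_left_cancel
    ((isUnit_eval3 hh (s + b) 0 (-(s + b) - c)).mul_right_cancel ?_)
  calc eval3 0 (s + b) c h * (eval3 s y z h * expSeries k (α • s) * eval3 y s (-s - y - z) h)
        * eval3 (s + b) 0 (-(s + b) - c) h
      = (eval3 0 (s + b) c h * eval3 s y z h) * expSeries k (α • s)
        * (eval3 y s (-s - y - z) h * eval3 (s + b) 0 (-(s + b) - c) h) := by
        simp only [mul_assoc]
    _ = eval3 s y 0 h * (eval3 0 (b + y) (c + z) h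
        * (expSeries k (α • s) * eval3 (b + y) 0 (-(b + y) - (c + z)) h)
        * expSeries k (-(α • s) + -(α • s))) * eval3 y s 0 h := by
        rw [E1, E2]
        simp only [mul_assoc]
    _ = eval3 s y 0 h * (expSeries k (-(α • (s + b + y))) * eval3 y s 0 h) := by
        rw [C1.eq, ← mul_assoc (eval3 0 (b + y) (c + z) h), E3, mul_assoc _ (expSeries k (α • s)),
          X1, mul_assoc]
    _ = expSeries k (-(α • y)) * (eval3 0 (s + b) c h * eval3 (s + b) 0 (-(s + b) - c) h) := by
        rw [C2.eq, ← mul_assoc, E5, one_mul, X2, E4]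
    _ = _ := by rw [← mul_assoc, C3.eq]

end

end Cyclotomic

namespace NCSeries

/-! ### Operators on the free algebra -/

section FreeAlgebra

variable {X k : Type*} [CommRing k]

/-- The derivation of the free algebra that sends the variable `x` to `v x`, as the second component
of a homomorphism to the trivial square-zero extension. -/
noncomputable def freeDeriv (v : X → FreeAlgebra k X) : Module.End k (FreeAlgebra k X) :=
  (TrivSqZeroExt.sndHom (FreeAlgebra k X) (FreeAlgebra k X)).restrictScalars k ∘ₗ
    (FreeAlgebra.lift k fun x => TrivSqZeroExt.inl (FreeAlgebra.ι k x) +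
      (TrivSqZeroExt.inr (v x) : TrivSqZeroExt (FreeAlgebra k X) (FreeAlgebra k X))).toLinearMap

theorem freeDeriv_ι_mul (v : X → FreeAlgebra k X) (x : X) (u : FreeAlgebra k X) :
    freeDeriv v (FreeAlgebra.ι k x * u) = v x * u + FreeAlgebra.ι k x * freeDeriv v u := by
  let φ := FreeAlgebra.lift k fun x => TrivSqZeroExt.inl (FreeAlgebra.ι k x) +
    (TrivSqZeroExt.inr (v x) : TrivSqZeroExt (FreeAlgebra k X) (FreeAlgebra k X))
  have hφ : φ (FreeAlgebra.ι k x) = TrivSqZeroExt.inl (FreeAlgebra.ι k x) +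
      TrivSqZeroExt.inr (v x) := FreeAlgebra.lift_ι_apply _ _
  have hfst : (TrivSqZeroExt.fstHom k (FreeAlgebra k X) (FreeAlgebra k X)).comp φ =
      AlgHom.id k _ := by
    ext x
    simp [φ]
  have hu : (φ u).fst = u := AlgHom.congr_fun hfst u
  change (φ (FreeAlgebra.ι k x * u)).snd = v x * u + FreeAlgebra.ι k x * (φ u).snd
  rw [map_mul, TrivSqZeroExt.snd_mul, hφ, hu]
  simp [add_comm]

/-- Left multiplication by the variable `x`. -/
noncomputable def mulVar (x : X) : Module.End k (FreeAlgebra k X) :=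
  LinearMap.mulLeft k (FreeAlgebra.ι k x)

theorem freeDeriv_mul_mulVar (v : X → FreeAlgebra k X) (x : X) :
    freeDeriv v * mulVar x = LinearMap.mulLeft k (v x) + mulVar x * freeDeriv v := by
  ext u
  exact freeDeriv_ι_mul v x u

/-- A series is determined by its evaluation at the left multiplications by the variables: the image
of `1` under the component of degree `n` is the component of degree `n` itself. -/
theorem eval_mulVar_injective [Fintype X] :
    Function.Injective (eval (k := k) (mulVar : X → Module.End k (FreeAlgebra k X))) := by
  classical
  have hprod (l : List X) : FreeAlgebra.equivMonoidAlgebraFreeMonoid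
      ((l.map mulVar).prod (1 : FreeAlgebra k X)) =
      MonoidAlgebra.single (FreeMonoid.ofList l) (1 : k) := by
    induction l with
    | nil => simp [MonoidAlgebra.one_def]
    | cons x l ih =>
      rw [List.map_cons, List.prod_cons, Module.End.mul_apply, mulVar, LinearMap.mulLeft_apply,
        map_mul, ih, FreeMonoid.ofList_cons]
      simp [FreeAlgebra.equivMonoidAlgebraFreeMonoid, MonoidAlgebra.single_mul_single]
  have hcoeff (f : NCSeries X k) (w : List X) : (FreeAlgebra.equivMonoidAlgebraFreeMonoid
      (evalCoeff mulVar w.length f (1 : FreeAlgebra k X))).coeff (FreeMonoid.ofList w) =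
      f.coeff w := by
    simp only [evalCoeff, LinearMap.sum_apply, LinearMap.smul_apply, map_sum, map_smul, hprod,
      MonoidAlgebra.smul_single, MonoidAlgebra.coeff_sum, Finsupp.finsetSum_apply,
      MonoidAlgebra.coeff_single, Finsupp.single_apply]
    rw [Finset.sum_eq_single w.get]
    · simp
    · intro v _ hv
      refine if_neg fun h => hv (List.ofFn_injective ?_)
      rw [List.ofFn_get]
      exact FreeMonoid.ofList.injective h
    · simp
  intro f g hfg
  ext w
  rw [← hcoeff f, ← hcoeff g, ← coeff_eval, hfg, coeff_eval]

end FreeAlgebra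

end NCSeries

namespace Cyclotomic

open NCSeries

variable {k : Type*} [CommRing k] [Algebra ℚ k]

/-- Duality for the left multiplications by the variables. The derivations
`D i j : e i ↦ [e i, e j], e j ↦ [e j, e i]`, which kill the third variable, complete them to a
representation as in `eval3_duality`. -/
theorem eval3_mulVar_duality {h : NCSeries (Gen3 2) k} (hh : h ∈ PENT 2 k) :
    let x : Gen3 2 → Module.End k (FreeAlgebra k (Gen3 2)) := mulVar
    eval3 (x none) (x (some 0)) (x (some 1)) h * expSeries k (coeffNegOne h • x none)
        * eval3 (x (some 0)) (x none) (-x none - x (some 0) - x (some 1)) h =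
      expSeries k (-(coeffNegOne h • x (some 0))) := by
  intro x
  let e : Gen3 2 → FreeAlgebra k (Gen3 2) := FreeAlgebra.ι k
  let D (i j : Gen3 2) : Module.End k (FreeAlgebra k (Gen3 2)) :=
    freeDeriv fun l => if l = i then e i * e j - e j * e i else if l = j then e j * e i - e i * e j
      else 0
  have hL (i j : Gen3 2) : LinearMap.mulLeft k (e i * e j - e j * e i) = x i * x j - x j * x i := by
    ext u
    simp [x, e, mulVar, sub_mul, mul_assoc]
  have hi {i j : Gen3 2} : D i j * x i = x i * x j - x j * x i + x i * D i j := by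
    rw [← hL, freeDeriv_mul_mulVar, if_pos rfl]
  have hj {i j : Gen3 2} (hij : j ≠ i) : D i j * x j = x j * x i - x i * x j + x j * D i j := by
    rw [← hL, freeDeriv_mul_mulVar, if_neg hij, if_pos rfl]
  have hl {i j l : Gen3 2} (hi : l ≠ i) (hj : l ≠ j) : D i j * x l = x l * D i j := by
    rw [freeDeriv_mul_mulVar, if_neg hi, if_neg hj, LinearMap.mulLeft_zero_eq_zero, zero_add]
  have h0 : (some 0 : Gen3 2) ≠ none := by decide
  have h1 : (some 1 : Gen3 2) ≠ none := by decide
  have h01 : (some 0 : Gen3 2) ≠ some 1 := by decide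
  refine eval3_duality hh (b := D none (some 0)) (c := D none (some 1)) ?_ ?_ ?_ ?_ ?_ ?_
  · simp only [Commute, SemiconjBy, mul_add, add_mul, hi]
    abel
  · simp only [Commute, SemiconjBy, mul_add, add_mul, hi]
    abel
  · simp only [Commute, SemiconjBy, mul_add, add_mul, hi, hj h0]
    abel
  · exact hl h1 h01.symm
  · exact hl h0 h01
  · simp only [Commute, SemiconjBy, mul_add, add_mul, hi, hj h1]
    abel

theorem involT_duality {h : NCSeries (Gen3 2) k} (hh : h ∈ PENT 2 k) :
    IsUnit (involT h) ∧ h = exp (-(coeffNegOne h • eOne)) * Ring.inverse (involT h)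
      * exp (-(coeffNegOne h • eZero)) := by
  have hu : IsUnit (involT h) := isUnit_subst _ hh.1.1
  refine ⟨hu, eval_mulVar_injective ?_⟩
  let x : Gen3 2 → Module.End k (FreeAlgebra k (Gen3 2)) := mulVar
  have hx : eval (k := k) x = eval3 (x none) (x (some 0)) (x (some 1)) := by
    refine congrArg _ (funext fun o => ?_)
    match o with
    | none => rfl
    | some 0 => rfl
    | some 1 => rfl
  have hT : eval x (involT h) =
      eval3 (x (some 0)) (x none) (-x none - x (some 0) - x (some 1)) h := by
    refine eval_subst _ _ _ (fun o => ?_) h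
    match o with
    | none => exact eval_var _ _
    | some 0 => exact eval_var _ _
    | some 1 =>
      change eval x (-eZero - eOne - eNegOne) = PowerSeries.monomial 1 _
      rw [eZero, eOne, eNegOne, map_sub, map_sub, map_neg, eval_var, eval_var, eval_var, ← map_neg,
        ← map_sub, ← map_sub]
      rfl
  have hexp (c : k) (o : Gen3 2) :
      eval x (exp (-(c • (var o : NCSeries (Gen3 2) k)))) = expSeries k (-(c • x o)) := by
    refine eval_exp _ ?_
    rw [map_neg, eval_smul, eval_var, map_neg]
    refine congrArg _ (PowerSeries.ext fun n => ?_)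
    change c • PowerSeries.coeff n (PowerSeries.monomial 1 (x o)) = _
    rw [PowerSeries.coeff_monomial, PowerSeries.coeff_monomial, smul_ite, smul_zero]
  have key := eval3_mulVar_duality hh
  change eval3 (x none) (x (some 0)) (x (some 1)) h * _ * eval3 (x (some 0)) (x none) _ h = _ at key
  rw [← hx, ← hT] at key
  have hinv : eval x (involT h) * eval x (Ring.inverse (involT h)) = 1 := by
    rw [← map_mul, Ring.mul_inverse_cancel _ hu, map_one]
  rw [map_mul, map_mul, eOne, eZero, hexp, hexp, ← key, mul_assoc _ (eval x (involT h)), hinv,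
    mul_one, mul_assoc, expSeries_mul_neg, mul_one]

end Cyclotomic

/-- Broadhurst duality for `PENT(2, k)`. -/
theorem proposition5p5 {k : Type*} [CommRing k] [Algebra ℚ k]
    (h : NCSeries (Cyclotomic.Gen3 2) k) (hh : h ∈ Cyclotomic.PENT 2 k) :
    IsUnit (Cyclotomic.involT h) ∧
      h = NCSeries.exp (-(Cyclotomic.coeffNegOne h • Cyclotomic.eOne))
        * Ring.inverse (Cyclotomic.involT h)
        * NCSeries.exp (-(Cyclotomic.coeffNegOne h • Cyclotomic.eZero)) :=
  Cyclotomic.involT_duality hh
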